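/- Let $1\le K\le n$ be integers and let $\mathcal C$ be a non-empty finite class of subsets of $\{1,\dots,n\}$, each of cardinality $K$; put $N=|\mathcal C|$. For $\mu>0$ let $\mathbb P_0$ be the law on $\mathbb R^n$ of a vector with i.i.d. $\mathcal N(0,1)$ components and, for $S\in\mathcal C$, let $\mathbb P_S$ be the law of a vector with independent components, the $i$-th being $\mathcal N(\mu,1)$ if $i\in S$ and $\mathcal N(0,1)$ if $i\notin S$; let $\phi_0$ and $\phi_S$ be the corresponding Lebesgue densities. The risk of a test $f:\mathbb R^n\to\{0,1\}$ is $$R(f)=\mathbb P_0\{f=1\}+\frac1N\sum_{S\in\mathcal C}\mathbb P_S\{f=0\},$$ and $R^*=R^*_{\mathcal C}(\mu)=R(f^*)$ denotes the risk of the optimal test $f^*$, where $f^*(x)=1$ if $\frac1N\sum_{S\in\mathcal C}\phi_S(x)/\phi_0(x)>1$ and $f^*(x)=0$ otherwise. Assume that $\mathcal C$ is symmetric in the following sense. Let $S,S'$ be drawn independently and uniformly at random from $\mathcal C$; then (i) the conditional distribution of $|S\cap S'|$ given $S'=T$ is the same for all $T\in\mathcal C$; and (ii) for every $S_0\in\mathcal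 C$ and every $i\in S_0$, $\mathbb P\{i\in S\}=K/n$. Assume moreover that $|\mathcal C|\le n^{\alpha}$ for some real $\alpha>0$. Then $R^*\ge \tfrac12$ for all $\mu>0$ with $$\mu\le\sqrt{\frac1K\log\Bigl(1+\frac nK\Bigr)},$$ and $R^*\le\tfrac12$ for all $\mu>0$ with $$\mu\ge\sqrt{\frac{2\alpha}{K}\log n}+\sqrt{\frac{8\log 4}{K}}.$$ -/

import Mathlib

open MeasureTheory ProbabilityTheory

noncomputable section

namespace SubsetDetection

variable {n : ℕ}

/-- The law of the observation under the null hypothesis: `n` i.i.d. standard normal components. -/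
def nullLaw (n : ℕ) : Measure (Fin n → ℝ) :=
  Measure.pi fun _ => gaussianReal 0 1

/-- The law of the observation when `S` is the contaminated set: independent components, with
distribution `N(μ, 1)` for `i ∈ S` and `N(0, 1)` for `i ∉ S`. -/
def altLaw (μ : ℝ) (S : Finset (Fin n)) : Measure (Fin n → ℝ) :=
  Measure.pi fun i => gaussianReal (if i ∈ S then μ else 0) 1

/-- The risk of a test `f` for the class `C`: the type I error plus the type II error averaged
over `C`. -/
def risk (C : Finset (Finset (Fin n))) (μ : ℝ) (f : (Fin n → ℝ) → Fin 2) : ℝ :=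
  (nullLaw n).real {x | f x = 1} + (1 / (C.card : ℝ)) * ∑ S ∈ C, (altLaw μ S).real {x | f x = 0}

/-- The density of the null law. -/
def nullDensity (x : Fin n → ℝ) : ℝ :=
  ∏ i, gaussianPDFReal 0 1 (x i)

/-- The density of the law with contaminated set `S`. -/
def altDensity (μ : ℝ) (S : Finset (Fin n)) (x : Fin n → ℝ) : ℝ :=
  ∏ i, gaussianPDFReal (if i ∈ S then μ else 0) 1 (x i)

/-- The likelihood ratio of the uniform mixture of the alternatives against the null law. -/
def likelihoodRatio (C : Finset (Finset (Fin n))) (μ : ℝ) (x : Fin n → ℝ) : ℝ :=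
  ((1 / (C.card : ℝ)) * ∑ S ∈ C, altDensity μ S x) / nullDensity x

/-- The optimal (likelihood ratio) test. -/
def optimalTest (C : Finset (Finset (Fin n))) (μ : ℝ) (x : Fin n → ℝ) : Fin 2 :=
  if 1 < likelihoodRatio C μ x then 1 else 0

/-- The Bayes risk `R*`, the risk of the optimal test. -/
def bayesRisk (C : Finset (Finset (Fin n))) (μ : ℝ) : ℝ :=
  risk C μ (optimalTest C μ)

/-- Subsets of a finite index set form a finite discrete space. -/
instance instMeasurableSpaceFinsetFin : MeasurableSpace (Finset (Fin n)) := ⊤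

/-- The law of a uniformly random element `S` of `C`. -/
def uniformLaw (C : Finset (Finset (Fin n))) : Measure (Finset (Fin n)) :=
  uniformOn (C : Set (Finset (Fin n)))

/-- The law of a pair `(S, S')` of independent uniformly random elements of `C`. -/
def pairLaw (C : Finset (Finset (Fin n))) : Measure (Finset (Fin n) × Finset (Fin n)) :=
  (uniformLaw C).prod (uniformLaw C)

/-- The symmetry conditions on a class `C` of sets of cardinality `K`. -/
structure IsSymmetricClass (C : Finset (Finset (Fin n))) (K : ℕ) : Prop where
  /-- The conditional distribution of `|S ∩ S'|` given `S' = T` is the same for all `T ∈ C`. -/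
  overlap : ∀ T ∈ C, ∀ T' ∈ C, ∀ z : ℕ,
    (pairLaw C)[{p | (p.1 ∩ p.2).card = z} | {p | p.2 = T}] =
      (pairLaw C)[{p | (p.1 ∩ p.2).card = z} | {p | p.2 = T'}]
  /-- Every index covered by the class lies in `S` with probability `K / n`. -/
  inclusion : ∀ S₀ ∈ C, ∀ i ∈ S₀, (uniformLaw C).real {S | i ∈ S} = (K : ℝ) / n

end SubsetDetection

end

namespace SubsetDetection

/-! Let L be the averaged likelihood ratio `avgWeight`. The optimal test pays the smaller of 1 and L
at each point, so R* = E₀ min(1, L). Lower bound: min(1, L) ≥ L - L²/4 and E₀ L = 1, so E₀ L² ≤ 2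
suffices (`half_le_bayesRisk_of_integral_sq_le`). The second moment is the average of exp(μ²|S ∩ T|)
over pairs. Convexity of exp (`exp_mul_le_chord`) reduces it to the mean overlap K²/n supplied by
symmetry (`sum_card_inter`). Upper bound: R* is at most the risk of the scan test, which Chernoff
and union bounds control (`risk_scanTest_le`). -/

/-! ### Gaussian shifts and their likelihood ratios -/

/-- The density of `⨂ N(a i, 1)` with respect to the standard normal law. -/
noncomputable def weight {n : ℕ} (a x : Fin n → ℝ) : ℝ :=
  ∏ i, Real.exp (a i * x i - a i ^ 2 / 2)

lemma weight_pos {n : ℕ} (a x : Fin n → ℝ) : 0 < weight a x :=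
  Finset.prod_pos fun _ _ => Real.exp_pos _

@[fun_prop]
lemma measurable_weight {n : ℕ} (a : Fin n → ℝ) : Measurable (weight a) := by
  unfold weight; fun_prop

instance {n : ℕ} : IsProbabilityMeasure (nullLaw n) := by
  unfold nullLaw; infer_instance

instance {n : ℕ} (μ : ℝ) (S : Finset (Fin n)) : IsProbabilityMeasure (altLaw μ S) := by
  unfold altLaw; infer_instance

lemma altLaw_zero {n : ℕ} (S : Finset (Fin n)) : altLaw 0 S = nullLaw n := by
  simp [altLaw, nullLaw]

lemma gaussianPDFReal_eq_mul_exp (m x : ℝ) :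
    gaussianPDFReal m 1 x = gaussianPDFReal 0 1 x * Real.exp (m * x - m ^ 2 / 2) := by
  simp only [gaussianPDFReal, mul_assoc, ← Real.exp_add]
  congr 2
  simp only [NNReal.coe_one]
  ring

lemma gaussianReal_eq_withDensity (m : ℝ) :
    gaussianReal m 1 = (gaussianReal 0 1).withDensity
      fun x => ENNReal.ofReal (Real.exp (m * x - m ^ 2 / 2)) := by
  rw [gaussianReal_of_var_ne_zero _ one_ne_zero, gaussianReal_of_var_ne_zero _ one_ne_zero,
    ← withDensity_mul _ (measurable_gaussianPDF _ _) (by fun_prop)]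
  congr 1
  ext x
  simp only [Pi.mul_apply, gaussianPDF]
  rw [gaussianPDFReal_eq_mul_exp m x,
    ENNReal.ofReal_mul (gaussianPDFReal_nonneg _ _ _)]

lemma integrable_exp_tilt (c d : ℝ) :
    Integrable (fun x : ℝ => Real.exp (c * x - d)) (gaussianReal 0 1) := by
  simp only [Real.exp_sub]
  exact (integrable_exp_mul_gaussianReal c).div_const _

lemma integral_exp_mul_gaussianReal (m c : ℝ) :
    ∫ x, Real.exp (c * x) ∂gaussianReal m 1 = Real.exp (m * c + c ^ 2 / 2) := by
  have h := congrFun (mgf_fun_id_gaussianReal (μ := m) (v := 1)) c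
  simpa [mgf] using h

lemma integral_exp_tilt (c d : ℝ) :
    ∫ x, Real.exp (c * x - d) ∂gaussianReal 0 1 = Real.exp (c ^ 2 / 2 - d) := by
  simp only [Real.exp_sub, integral_div]
  rw [integral_exp_mul_gaussianReal]
  simp

lemma integrable_weight {n : ℕ} (a : Fin n → ℝ) : Integrable (weight a) (nullLaw n) :=
  Integrable.fintype_prod (f := fun i y => Real.exp (a i * y - a i ^ 2 / 2))
    fun _ => integrable_exp_tilt _ _

lemma weight_mul_weight {n : ℕ} (a b x : Fin n → ℝ) :
    weight a x * weight b x =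
      ∏ i, Real.exp ((a i + b i) * x i - (a i ^ 2 / 2 + b i ^ 2 / 2)) := by
  rw [weight, weight, ← Finset.prod_mul_distrib]
  refine Finset.prod_congr rfl fun i _ => ?_
  rw [← Real.exp_add]
  ring_nf

lemma integrable_weight_mul_weight {n : ℕ} (a b : Fin n → ℝ) :
    Integrable (fun x => weight a x * weight b x) (nullLaw n) := by
  simp only [weight_mul_weight]
  exact Integrable.fintype_prod
    (f := fun i y => Real.exp ((a i + b i) * y - (a i ^ 2 / 2 + b i ^ 2 / 2)))
    fun _ => integrable_exp_tilt _ _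

/-- Coordinatewise, (a + b)²/2 - a²/2 - b²/2 = ab. -/
lemma integral_weight_mul_weight {n : ℕ} (a b : Fin n → ℝ) :
    ∫ x, weight a x * weight b x ∂nullLaw n = Real.exp (∑ i, a i * b i) := by
  simp only [weight_mul_weight, nullLaw]
  rw [integral_fintype_prod_eq_prod
    (fun i y => Real.exp ((a i + b i) * y - (a i ^ 2 / 2 + b i ^ 2 / 2))), Real.exp_sum]
  refine Finset.prod_congr rfl fun i _ => ?_
  rw [integral_exp_tilt]
  ring_nf

lemma pi_gaussianReal_eq_withDensity {n : ℕ} (a : Fin n → ℝ) :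
    Measure.pi (fun i => gaussianReal (a i) 1) =
      (nullLaw n).withDensity fun x => ENNReal.ofReal (weight a x) := by
  refine Measure.pi_eq fun s hs => ?_
  rw [withDensity_apply _ (MeasurableSet.univ_pi hs),
    ← ofReal_integral_eq_lintegral_ofReal (integrable_weight a).integrableOn
      (ae_of_all _ fun x => (weight_pos a x).le)]
  unfold nullLaw weight
  rw [Measure.restrict_pi_pi, integral_fintype_prod_eq_prod
    (fun i y => Real.exp (a i * y - a i ^ 2 / 2)),
    ENNReal.ofReal_prod_of_nonneg fun i _ => integral_nonneg fun _ => (Real.exp_pos _).le]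
  refine Finset.prod_congr rfl fun i _ => ?_
  rw [gaussianReal_eq_withDensity (a i), withDensity_apply _ (hs i),
    ← ofReal_integral_eq_lintegral_ofReal (integrable_exp_tilt _ _).integrableOn
      (ae_of_all _ fun x => (Real.exp_pos _).le)]

/-- The mean vector of the alternative with contaminated set `S`. -/
def shift {n : ℕ} (μ : ℝ) (S : Finset (Fin n)) (i : Fin n) : ℝ := if i ∈ S then μ else 0

lemma altLaw_real_eq_setIntegral {n : ℕ} (μ : ℝ) (S : Finset (Fin n)) {A : Set (Fin n → ℝ)}
    (hA : MeasurableSet A) :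
    (altLaw μ S).real A = ∫ x in A, weight (shift μ S) x ∂nullLaw n := by
  have h : altLaw μ S = (nullLaw n).withDensity fun x => ENNReal.ofReal (weight (shift μ S) x) :=
    pi_gaussianReal_eq_withDensity (shift μ S)
  rw [Measure.real, h, withDensity_apply _ hA,
    ← ofReal_integral_eq_lintegral_ofReal (integrable_weight _).integrableOn
      (ae_of_all _ fun x => (weight_pos _ x).le),
    ENNReal.toReal_ofReal (integral_nonneg fun x => (weight_pos _ x).le)]

lemma sum_shift_mul_shift {n : ℕ} (μ : ℝ) (S T : Finset (Fin n)) :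
    ∑ i, shift μ S i * shift μ T i = μ ^ 2 * (S ∩ T).card := by
  have h (i : Fin n) : shift μ S i * shift μ T i = if i ∈ S ∩ T then μ ^ 2 else 0 := by
    by_cases h1 : i ∈ S <;> by_cases h2 : i ∈ T <;> simp [shift, h1, h2, sq]
  simp only [h, Finset.sum_ite_mem, Finset.univ_inter, Finset.sum_const, nsmul_eq_mul]
  ring

lemma integral_weight {n : ℕ} (a : Fin n → ℝ) : ∫ x, weight a x ∂nullLaw n = 1 := by
  have h := integral_weight_mul_weight a 0
  simpa [weight] using h

/-! ### Averaged likelihood ratio and Bayes risk -/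

/-- The uniform average of the likelihood ratios. -/
noncomputable def avgWeight {n : ℕ} (C : Finset (Finset (Fin n))) (μ : ℝ) (x : Fin n → ℝ) : ℝ :=
  1 / (C.card : ℝ) * ∑ S ∈ C, weight (shift μ S) x

lemma likelihoodRatio_eq_avgWeight {n : ℕ} (C : Finset (Finset (Fin n))) (μ : ℝ)
    (x : Fin n → ℝ) : likelihoodRatio C μ x = avgWeight C μ x := by
  have h0 : nullDensity x ≠ 0 :=
    Finset.prod_ne_zero_iff.2 fun i _ => (gaussianPDFReal_pos 0 1 (x i) one_ne_zero).ne'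
  have h (S : Finset (Fin n)) : altDensity μ S x = nullDensity x * weight (shift μ S) x := by
    rw [altDensity, nullDensity, weight, ← Finset.prod_mul_distrib]
    exact Finset.prod_congr rfl fun i _ => gaussianPDFReal_eq_mul_exp _ _
  rw [likelihoodRatio, avgWeight]
  simp only [h, ← Finset.mul_sum]
  field_simp

@[fun_prop]
lemma measurable_avgWeight {n : ℕ} (C : Finset (Finset (Fin n))) (μ : ℝ) :
    Measurable (avgWeight C μ) := by
  unfold avgWeight; fun_prop

lemma integrable_avgWeight {n : ℕ} (C : Finset (Finset (Fin n))) (μ : ℝ) :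
    Integrable (avgWeight C μ) (nullLaw n) :=
  (integrable_finsetSum C fun _ _ => integrable_weight _).const_mul _

lemma integral_avgWeight {n : ℕ} {C : Finset (Finset (Fin n))} (hC : C.Nonempty) (μ : ℝ) :
    ∫ x, avgWeight C μ x ∂nullLaw n = 1 := by
  have h : (C.card : ℝ) ≠ 0 := by exact_mod_cast hC.card_pos.ne'
  simp only [avgWeight]
  rw [integral_const_mul, integral_finsetSum C fun _ _ => integrable_weight _]
  simp [integral_weight, h]

lemma avgWeight_sq {n : ℕ} (C : Finset (Finset (Fin n))) (μ : ℝ) (x : Fin n → ℝ) :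
    avgWeight C μ x ^ 2 = (1 / (C.card : ℝ)) ^ 2 *
      ∑ S ∈ C, ∑ T ∈ C, weight (shift μ S) x * weight (shift μ T) x := by
  rw [avgWeight, mul_pow, sq (∑ S ∈ C, _), Finset.sum_mul_sum]

lemma integrable_avgWeight_sq {n : ℕ} (C : Finset (Finset (Fin n))) (μ : ℝ) :
    Integrable (fun x => avgWeight C μ x ^ 2) (nullLaw n) := by
  simp only [avgWeight_sq]
  exact (integrable_finsetSum C fun _ _ => integrable_finsetSum C fun _ _ =>
    integrable_weight_mul_weight _ _).const_mul _

lemma integral_avgWeight_sq {n : ℕ} (C : Finset (Finset (Fin n))) (μ : ℝ) :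
    ∫ x, avgWeight C μ x ^ 2 ∂nullLaw n = (1 / (C.card : ℝ)) ^ 2 *
      ∑ S ∈ C, ∑ T ∈ C, Real.exp (μ ^ 2 * (S ∩ T).card) := by
  simp only [avgWeight_sq]
  rw [integral_const_mul, integral_finsetSum C fun _ _ => integrable_finsetSum C fun _ _ =>
    integrable_weight_mul_weight _ _]
  congr 1
  refine Finset.sum_congr rfl fun S _ => ?_
  rw [integral_finsetSum C fun _ _ => integrable_weight_mul_weight _ _]
  simp only [integral_weight_mul_weight, sum_shift_mul_shift]

/-- The risk is the integral of `1` over the rejection region and the likelihood ratio outside. -/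
lemma risk_eq_integral {n : ℕ} (C : Finset (Finset (Fin n))) (μ : ℝ) (f : (Fin n → ℝ) → Fin 2)
    (hf : Measurable f) :
    risk C μ f = ∫ x, {x | f x = 1}.indicator 1 x + {x | f x = 0}.indicator (avgWeight C μ) x
      ∂nullLaw n := by
  have h1 : MeasurableSet {x | f x = 1} := hf (measurableSet_singleton 1)
  have h0 : MeasurableSet {x | f x = 0} := hf (measurableSet_singleton 0)
  rw [integral_add (f := {x | f x = 1}.indicator 1)
    ((integrable_const (1 : ℝ)).indicator h1) ((integrable_avgWeight C μ).indicator h0), integral_indicator_one h1, integral_indicator h0,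
    risk]
  simp only [avgWeight, altLaw_real_eq_setIntegral μ _ h0]
  rw [integral_const_mul, integral_finsetSum C fun _ _ => (integrable_weight _).integrableOn]

lemma measurable_optimalTest {n : ℕ} (C : Finset (Finset (Fin n))) (μ : ℝ) :
    Measurable (optimalTest C μ) := by
  unfold optimalTest
  simp only [likelihoodRatio_eq_avgWeight]
  exact Measurable.ite (measurableSet_lt measurable_const (measurable_avgWeight C μ))
    measurable_const measurable_const

lemma bayesRisk_eq_integral_min {n : ℕ} (C : Finset (Finset (Fin n))) (μ : ℝ) :
    bayesRisk C μ = ∫ x, min 1 (avgWeight C μ x) ∂nullLaw n := by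
  rw [bayesRisk, risk_eq_integral C μ _ (measurable_optimalTest C μ)]
  congr 1
  ext x
  by_cases h : 1 < avgWeight C μ x
  · simp [optimalTest, likelihoodRatio_eq_avgWeight, h, h.le, Set.indicator]
  · simp [optimalTest, likelihoodRatio_eq_avgWeight, h, not_lt.1 h, Set.indicator]

/-- Any test pays either 1 or L at each point, hence at least min(1, L). -/
lemma bayesRisk_le_risk {n : ℕ} (C : Finset (Finset (Fin n))) (μ : ℝ) (f : (Fin n → ℝ) → Fin 2)
    (hf : Measurable f) : bayesRisk C μ ≤ risk C μ f := by
  have h1 : MeasurableSet {x | f x = 1} := hf (measurableSet_singleton 1)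
  have h0 : MeasurableSet {x | f x = 0} := hf (measurableSet_singleton 0)
  rw [bayesRisk_eq_integral_min, risk_eq_integral C μ f hf]
  refine integral_mono ((integrable_const 1).inf (integrable_avgWeight C μ))
    (((integrable_const (1 : ℝ)).indicator h1).add ((integrable_avgWeight C μ).indicator h0))
    fun x => ?_
  have h : f x = 0 ∨ f x = 1 := by
    generalize f x = y
    fin_cases y <;> simp
  rcases h with h | h <;> simp [h, Set.indicator]

/-- The second-moment bound on the Bayes risk. -/
lemma half_le_bayesRisk_of_integral_sq_le {n : ℕ} {C : Finset (Finset (Fin n))} (hC : C.Nonempty)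
    {μ : ℝ} (h : ∫ x, avgWeight C μ x ^ 2 ∂nullLaw n ≤ 2) : 1 / 2 ≤ bayesRisk C μ := by
  have hL := integrable_avgWeight C μ
  have hL2 := integrable_avgWeight_sq C μ
  have hmono : ∫ x, (avgWeight C μ x - avgWeight C μ x ^ 2 / 4) ∂nullLaw n ≤ bayesRisk C μ := by
    rw [bayesRisk_eq_integral_min]
    refine integral_mono (hL.sub (hL2.div_const 4)) ((integrable_const 1).inf hL) fun x => ?_
    -- L - L²/4 ≤ 1 is (L/2 - 1)² ≥ 0; the constant 1/4 makes this parabola peak exactly at 1.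
    refine le_min ?_ ?_
    · dsimp only
      nlinarith [sq_nonneg (avgWeight C μ x - 2)]
    · dsimp only
      nlinarith [sq_nonneg (avgWeight C μ x)]
  rw [integral_sub hL (hL2.div_const 4), integral_avgWeight hC, integral_div] at hmono
  linarith

/-! ### Overlaps in a symmetric class and the lower bound -/

lemma uniformLaw_real_eq {n : ℕ} (C : Finset (Finset (Fin n))) (i : Fin n) :
    (uniformLaw C).real {S | i ∈ S} = ((C.filter (i ∈ ·)).card : ℝ) / C.card := by
  have h : (uniformLaw C) {S | i ∈ S} = uniformLaw C ((C.filter (i ∈ ·) : Finset _) : Set _) := by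
    rw [uniformLaw, ← uniformOn_inter_self C.finite_toSet]
    congr 1
    ext S
    simp
  rw [Measure.real, h, uniformLaw, uniformOn_apply_finset' MeasurableSpace.measurableSet_top
      MeasurableSpace.measurableSet_top,
    Finset.inter_eq_right.2 (Finset.filter_subset _ _)]
  simp

/-- On [0, k] a convex function lies below its chord. The bound is affine in z, so averaging it over
overlaps needs only their mean. -/
lemma exp_mul_le_chord {c z k : ℝ} (hk : 0 < k) (hz : 0 ≤ z) (hzk : z ≤ k) :
    Real.exp (c * z) ≤ 1 + z / k * (Real.exp (c * k) - 1) := by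
  have h := convexOn_exp.2 (Set.mem_univ (0 : ℝ)) (Set.mem_univ (c * k))
    (sub_nonneg.2 ((div_le_one hk).2 hzk)) (div_nonneg hz hk.le) (sub_add_cancel 1 (z / k))
  have e : z / k * (c * k) = c * z := by field_simp
  simp only [smul_eq_mul, mul_zero, zero_add, Real.exp_zero, mul_one, e] at h
  linarith

/-- The overlaps with a fixed member of a symmetric class have average `K ^ 2 / n`. -/
lemma sum_card_inter {n K : ℕ} {C : Finset (Finset (Fin n))} (hcard : ∀ S ∈ C, S.card = K)
    (hsymm : IsSymmetricClass C K) {T : Finset (Fin n)} (hT : T ∈ C) :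
    ∑ S ∈ C, ((T ∩ S).card : ℝ) = K * (C.card * (K / n)) := by
  have hN : (C.card : ℝ) ≠ 0 := by exact_mod_cast (Finset.card_pos.2 ⟨T, hT⟩).ne'
  -- Double counting of the pairs (i, S) with i ∈ T ∩ S.
  have h1 : ∑ S ∈ C, (T ∩ S).card = ∑ i ∈ T, (C.filter (i ∈ ·)).card := by
    simp only [← Finset.filter_mem_eq_inter, Finset.card_eq_sum_ones, Finset.sum_filter]
    exact Finset.sum_comm
  have h2 (i : Fin n) (hi : i ∈ T) : ((C.filter (i ∈ ·)).card : ℝ) = C.card * (K / n) := by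
    have h := hsymm.inclusion T hT i hi
    rw [uniformLaw_real_eq] at h
    rw [← h]
    field_simp
  rw [← Nat.cast_sum, h1, Nat.cast_sum, Finset.sum_congr rfl h2, Finset.sum_const, hcard T hT,
    nsmul_eq_mul]

lemma sum_exp_card_inter_le {n K : ℕ} (hK : 1 ≤ K) {C : Finset (Finset (Fin n))}
    (hcard : ∀ S ∈ C, S.card = K) (hsymm : IsSymmetricClass C K) {c : ℝ}
    (hc : Real.exp (c * K) ≤ 1 + (n : ℝ) / K) {T : Finset (Fin n)} (hT : T ∈ C) :
    ∑ S ∈ C, Real.exp (c * (T ∩ S).card) ≤ 2 * C.card := by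
  have hK0 : (0 : ℝ) < K := by exact_mod_cast hK
  have hKn : K ≤ n := by simpa [hcard T hT] using Finset.card_le_univ T
  have hn0 : (0 : ℝ) < n := by exact_mod_cast hK.trans hKn
  calc ∑ S ∈ C, Real.exp (c * (T ∩ S).card)
      ≤ ∑ S ∈ C, (1 + ((T ∩ S).card : ℝ) / K * (Real.exp (c * K) - 1)) := by
        refine Finset.sum_le_sum fun S _ => exp_mul_le_chord hK0 (Nat.cast_nonneg _) ?_
        rw [← hcard T hT]
        exact_mod_cast Finset.card_le_card Finset.inter_subset_left
    _ = C.card + C.card * (K / n) * (Real.exp (c * K) - 1) := by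
        rw [Finset.sum_add_distrib, ← Finset.sum_mul, ← Finset.sum_div,
          sum_card_inter hcard hsymm hT]
        simp only [Finset.sum_const, nsmul_eq_mul, mul_one]
        field_simp
    -- The threshold on μ is exactly what makes the excess exp(cK) - 1 at most n/K, cancelling K/n.
    _ ≤ C.card + C.card * (K / n) * (n / K) := by
        gcongr
        linarith
    _ = 2 * C.card := by
        field_simp
        ring

/-- Below the detection threshold the Bayes risk is at least `1 / 2`. -/
lemma half_le_bayesRisk {n K : ℕ} (hK : 1 ≤ K) {C : Finset (Finset (Fin n))} (hC : C.Nonempty)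
    (hcard : ∀ S ∈ C, S.card = K) (hsymm : IsSymmetricClass C K) {μ : ℝ}
    (hμ : Real.exp (μ ^ 2 * K) ≤ 1 + (n : ℝ) / K) : 1 / 2 ≤ bayesRisk C μ := by
  refine half_le_bayesRisk_of_integral_sq_le hC ?_
  have hN : (0 : ℝ) < C.card := by exact_mod_cast hC.card_pos
  rw [integral_avgWeight_sq]
  calc (1 / (C.card : ℝ)) ^ 2 * ∑ S ∈ C, ∑ T ∈ C, Real.exp (μ ^ 2 * (S ∩ T).card)
      ≤ (1 / (C.card : ℝ)) ^ 2 * ∑ S ∈ C, (2 * C.card : ℝ) := by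
        gcongr with S hS
        exact sum_exp_card_inter_le hK hcard hsymm hμ hS
    _ = 2 := by
        rw [Finset.sum_const, nsmul_eq_mul]
        field_simp

/-! ### Chernoff bounds, the scan test and the upper bound -/

lemma exp_mul_sum_eq_prod {n : ℕ} (S : Finset (Fin n)) (c : ℝ) (x : Fin n → ℝ) :
    Real.exp (c * ∑ i ∈ S, x i) = ∏ i, Real.exp ((if i ∈ S then c else 0) * x i) := by
  rw [← Real.exp_sum, Finset.mul_sum]
  simp [ite_mul, Finset.sum_ite_mem]

lemma integrable_exp_mul_sum {n : ℕ} (μ : ℝ) (S : Finset (Fin n)) (c : ℝ) :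
    Integrable (fun x => Real.exp (c * ∑ i ∈ S, x i)) (altLaw μ S) := by
  simp only [exp_mul_sum_eq_prod]
  exact Integrable.fintype_prod (f := fun i y => Real.exp ((if i ∈ S then c else 0) * y))
    fun _ => integrable_exp_mul_gaussianReal _

lemma mgf_sum_altLaw {n : ℕ} (μ : ℝ) (S : Finset (Fin n)) (c : ℝ) :
    mgf (fun x => ∑ i ∈ S, x i) (altLaw μ S) c = Real.exp (S.card * (μ * c + c ^ 2 / 2)) := by
  simp only [mgf, exp_mul_sum_eq_prod, altLaw]
  rw [integral_fintype_prod_eq_prod (fun i y => Real.exp ((if i ∈ S then c else 0) * y))]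
  simp only [integral_exp_mul_gaussianReal]
  have h (i : Fin n) : Real.exp ((if i ∈ S then μ else 0) * (if i ∈ S then c else 0) +
      (if i ∈ S then c else 0) ^ 2 / 2) = if i ∈ S then Real.exp (μ * c + c ^ 2 / 2) else 1 := by
    split_ifs <;> simp
  simp only [h, Finset.prod_ite_mem, Finset.univ_inter, Finset.prod_const, ← Real.exp_nat_mul]

/-- Chernoff bound at the optimal exponent t; the null law is the case μ = 0 of `mgf_sum_altLaw`. -/
lemma nullLaw_real_sum_ge_le {n : ℕ} (S : Finset (Fin n)) {t : ℝ}
    (ht : 0 ≤ t) :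
    (nullLaw n).real {x | S.card * t ≤ ∑ i ∈ S, x i} ≤ Real.exp (-(S.card * t ^ 2 / 2)) := by
  have h := measure_ge_le_exp_mul_mgf (X := fun x : Fin n → ℝ => ∑ i ∈ S, x i) (S.card * t) ht
    (integrable_exp_mul_sum 0 S t)
  rw [mgf_sum_altLaw, altLaw_zero, ← Real.exp_add] at h
  refine h.trans_eq ?_
  ring_nf

/-- The optimal Chernoff exponent is now t - μ ≤ 0. -/
lemma altLaw_real_sum_le_le {n : ℕ} (μ : ℝ) (S : Finset (Fin n)) {t : ℝ} (ht : t ≤ μ) :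
    (altLaw μ S).real {x | ∑ i ∈ S, x i ≤ S.card * t} ≤
      Real.exp (-(S.card * (μ - t) ^ 2 / 2)) := by
  have h := measure_le_le_exp_mul_mgf (X := fun x : Fin n → ℝ => ∑ i ∈ S, x i) (S.card * t)
    (sub_nonpos.2 ht) (integrable_exp_mul_sum μ S (t - μ))
  rw [mgf_sum_altLaw, ← Real.exp_add] at h
  refine h.trans_eq ?_
  ring_nf

open Classical in
/-- The scan test, rejecting when some `S ∈ C` has empirical mean at least `t`. -/
noncomputable def scanTest {n : ℕ} (C : Finset (Finset (Fin n))) (t : ℝ) (x : Fin n → ℝ) : Fin 2 :=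
  if ∃ S ∈ C, S.card * t ≤ ∑ i ∈ S, x i then 1 else 0

lemma scanTest_eq_one_iff {n : ℕ} {C : Finset (Finset (Fin n))} {t : ℝ} {x : Fin n → ℝ} :
    scanTest C t x = 1 ↔ ∃ S ∈ C, S.card * t ≤ ∑ i ∈ S, x i := by
  simp [scanTest]

lemma scanTest_eq_zero_iff {n : ℕ} {C : Finset (Finset (Fin n))} {t : ℝ} {x : Fin n → ℝ} :
    scanTest C t x = 0 ↔ ∀ S ∈ C, ∑ i ∈ S, x i < S.card * t := by
  simp [scanTest]

lemma measurable_scanTest {n : ℕ} (C : Finset (Finset (Fin n))) (t : ℝ) :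
    Measurable (scanTest C t) := by
  classical
  unfold scanTest
  refine Measurable.ite ?_ measurable_const measurable_const
  have h : {x : Fin n → ℝ | ∃ S ∈ C, S.card * t ≤ ∑ i ∈ S, x i} =
      ⋃ S ∈ C, {x | S.card * t ≤ ∑ i ∈ S, x i} := by
    ext x; simp
  rw [h]
  exact C.measurableSet_biUnion fun S _ => measurableSet_le (by fun_prop) (by fun_prop)

lemma risk_scanTest_le {n K : ℕ} {C : Finset (Finset (Fin n))} (hC : C.Nonempty)
    (hcard : ∀ S ∈ C, S.card = K) {μ t : ℝ} (ht : 0 ≤ t) (htμ : t ≤ μ) :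
    risk C μ (scanTest C t) ≤
      C.card * Real.exp (-(K * t ^ 2 / 2)) + Real.exp (-(K * (μ - t) ^ 2 / 2)) := by
  have hN : (C.card : ℝ) ≠ 0 := by exact_mod_cast hC.card_pos.ne'
  refine add_le_add ?_ ?_
  · have h : {x | scanTest C t x = 1} = ⋃ S ∈ C, {x | S.card * t ≤ ∑ i ∈ S, x i} := by
      ext x; simp [scanTest_eq_one_iff]
    rw [h]
    refine (measureReal_biUnion_finset_le _ _).trans ?_
    rw [← nsmul_eq_mul]
    refine Finset.sum_le_card_nsmul _ _ _ fun S hS => ?_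
    rw [← hcard S hS]
    exact nullLaw_real_sum_ge_le S ht
  · calc 1 / (C.card : ℝ) * ∑ S ∈ C, (altLaw μ S).real {x | scanTest C t x = 0}
        ≤ 1 / (C.card : ℝ) * ∑ S ∈ C, Real.exp (-(K * (μ - t) ^ 2 / 2)) := by
          gcongr with S hS
          refine (measureReal_mono fun x hx => ?_).trans
            ((altLaw_real_sum_le_le μ S htμ).trans_eq (by rw [hcard S hS]))
          exact (scanTest_eq_zero_iff.1 hx S hS).le
      _ = Real.exp (-(K * (μ - t) ^ 2 / 2)) := by
          rw [Finset.sum_const, nsmul_eq_mul]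
          field_simp

/-- Above the detection threshold the Bayes risk is at most `1 / 2`. -/
lemma bayesRisk_le_half {n K : ℕ} (hK : 1 ≤ K) {C : Finset (Finset (Fin n))} (hC : C.Nonempty)
    (hcard : ∀ S ∈ C, S.card = K) {α : ℝ} (hα : 0 < α) (hsize : (C.card : ℝ) ≤ (n : ℝ) ^ α)
    {μ : ℝ} (hμ : Real.sqrt (2 * α / (K : ℝ) * Real.log n) +
      Real.sqrt (8 * Real.log 4 / (K : ℝ)) ≤ μ) : bayesRisk C μ ≤ 1 / 2 := by
  obtain ⟨T, hT⟩ := hC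
  have hK0 : (0 : ℝ) < K := by exact_mod_cast hK
  have hKn : K ≤ n := by simpa [hcard T hT] using Finset.card_le_univ T
  have hn0 : (0 : ℝ) < n := by exact_mod_cast hK.trans hKn
  have hlog : 0 ≤ Real.log n := Real.log_natCast_nonneg n
  have hlog4 : 0 < Real.log 4 := Real.log_pos (by norm_num)
  set a := Real.sqrt (2 * α / (K : ℝ) * Real.log n)
  set s := Real.sqrt (8 * Real.log 4 / (K : ℝ))
  have ha : a ^ 2 = 2 * α / (K : ℝ) * Real.log n := Real.sq_sqrt (by positivity)
  have hs : s ^ 2 = 8 * Real.log 4 / (K : ℝ) := Real.sq_sqrt (by positivity)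
  have ha' : K * a ^ 2 = 2 * α * Real.log n := by rw [ha]; field_simp
  have hs' : K * s ^ 2 = 8 * Real.log 4 := by rw [hs]; field_simp
  have ha0 : 0 ≤ a := Real.sqrt_nonneg _
  have hs0 : 0 ≤ s := Real.sqrt_nonneg _
  have hquarter : Real.exp (-Real.log 4) = 1 / 4 := by
    rw [Real.exp_neg, Real.exp_log (by norm_num)]; norm_num
  -- Scan threshold t = a + s/2: dropping the cross term, Kt²/2 ≥ Ka²/2 + Ks²/8 = α log n + log 4.
  -- The first summand pays for the union bound, the second leaves 1/4.
  have h1 : C.card * Real.exp (-(K * (a + s / 2) ^ 2 / 2)) ≤ 1 / 4 := by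
    calc C.card * Real.exp (-(K * (a + s / 2) ^ 2 / 2))
        ≤ (n : ℝ) ^ α * Real.exp (-(α * Real.log n) + -Real.log 4) := by
          gcongr
          nlinarith [mul_nonneg hK0.le (mul_nonneg ha0 hs0)]
      _ = 1 / 4 := by
          rw [Real.exp_add, hquarter, Real.rpow_def_of_pos hn0, ← mul_assoc, ← Real.exp_add,
            mul_comm α, add_neg_cancel, Real.exp_zero, one_mul]
  -- The other half of s is the margin μ - t ≥ s/2, and Ks²/8 = log 4.
  have h2 : Real.exp (-(K * (μ - (a + s / 2)) ^ 2 / 2)) ≤ 1 / 4 := by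
    rw [← hquarter, Real.exp_le_exp]
    have h : (s / 2) ^ 2 ≤ (μ - (a + s / 2)) ^ 2 :=
      pow_le_pow_left₀ (by positivity) (by linarith) 2
    nlinarith [mul_le_mul_of_nonneg_left h hK0.le]
  refine (bayesRisk_le_risk C μ _ (measurable_scanTest C (a + s / 2))).trans
    ((risk_scanTest_le ⟨T, hT⟩ hcard (by positivity) (by linarith)).trans ?_)
  linarith

end SubsetDetection

theorem mainTheorem10 (n K : ℕ) (hK : 1 ≤ K) (C : Finset (Finset (Fin n)))
    (hC : C.Nonempty) (hcard : ∀ S ∈ C, S.card = K)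
    (hsymm : SubsetDetection.IsSymmetricClass C K)
    (α : ℝ) (hα : 0 < α) (hsize : (C.card : ℝ) ≤ (n : ℝ) ^ α) :
    (∀ μ : ℝ, 0 < μ → μ ≤ Real.sqrt (1 / (K : ℝ) * Real.log (1 + (n : ℝ) / K)) →
      1 / 2 ≤ SubsetDetection.bayesRisk C μ) ∧
    (∀ μ : ℝ, 0 < μ →
      Real.sqrt (2 * α / (K : ℝ) * Real.log n) + Real.sqrt (8 * Real.log 4 / (K : ℝ)) ≤ μ →
      SubsetDetection.bayesRisk C μ ≤ 1 / 2) := by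
  have hK0 : (0 : ℝ) < K := by exact_mod_cast hK
  refine ⟨fun μ hμ0 hμ => ?_, fun μ _ hμ =>
    SubsetDetection.bayesRisk_le_half hK hC hcard hα hsize hμ⟩
  refine SubsetDetection.half_le_bayesRisk hK hC hcard hsymm ?_
  have h := (Real.le_sqrt' hμ0).1 hμ
  rw [← Real.le_log_iff_exp_le (by positivity), mul_comm]
  calc K * μ ^ 2 ≤ K * (1 / (K : ℝ) * Real.log (1 + (n : ℝ) / K)) := by gcongr
    _ = Real.log (1 + (n : ℝ) / K) := by field_simp
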